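/- Let $n \geq 3$ and let $F_n$ be the free group on $x_1, \dots, x_n$. For a group $G$ let $R(G) = \mathrm{Hom}(G, \mathrm{SL}(2,\mathbb{C}))$, and for $x \in G$ let $\mathrm{tr}\,x : R(G) \to \mathbb{C}$ be the function $\rho \mapsto \mathrm{tr}\,\rho(x)$. The $\mathbb{Q}$-linear span $\mathfrak{X}_{\mathbb{Q}}(G)$ of all $\mathrm{tr}\,x$ ($x \in G$) is a subring of the ring of functions $R(G) \to \mathbb{C}$ (the ring of Fricke characters of $G$ over $\mathbb{Q}$), and $\mathrm{Aut}\,G$ acts on it by ring automorphisms with $\sigma \cdot \mathrm{tr}\,x = \mathrm{tr}\,\sigma(x)$. Let $J \subset \mathfrak{X}_{\mathbb{Q}}(F_n)$ be the ideal generated by the elements $\mathrm{tr}(x_{i_1} \cdots x_{i_l}) - 2$ with $1 \leq l \leq 3$ and $1 \leq i_1 < \cdots < i_l \leq n$; it is stable under $\mathrm{Aut}\,F_n$. For $k \geq 1$ let \[ \mathcal{E}_{F_n}(k) = \mathrm{Ker}\bigl(\mathrm{Aut}\,F_n \to \mathrm{Aut}(J/J^{k+1})\bigr), \qquad \mathcal{A}_{F_n}(k)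 = \mathrm{Ker}\bigl(\mathrm{Aut}\,F_n \to \mathrm{Aut}(F_n/\Gamma(k+1))\bigr), \] where $\Gamma(1) = F_n$ and $\Gamma(k+1) = [\Gamma(k), F_n]$, and let $\mathrm{Inn}\,F_n$ be the group of inner automorphisms. Then \[ \mathcal{E}_{F_n}(1) = \mathrm{Inn}\,F_n \cdot \mathcal{A}_{F_n}(2). \] -/

import Mathlib

noncomputable section

namespace Fricke

open Matrix

section General

variable (G : Type*) [Group G]

/-- `R(G) = Hom(G, SL(2, ℂ))`. -/
abbrev Reps : Type _ := G →* SpecialLinearGroup (Fin 2) ℂ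

variable {G}

/-- The function `tr x : R(G) → ℂ`, `ρ ↦ tr ρ(x)`. -/
def trFun (x : G) : Reps G → ℂ := fun ρ => Matrix.trace (ρ x : Matrix (Fin 2) (Fin 2) ℂ)

theorem sl2_trace_mul (A B : SpecialLinearGroup (Fin 2) ℂ) :
    Matrix.trace A.1 * Matrix.trace B.1 = Matrix.trace (A * B).1 + Matrix.trace (A * B⁻¹).1 := by
  have h1 : (A * B).1 = A.1 * B.1 := rfl
  have h2 : (A * B⁻¹).1 = A.1 * adjugate B.1 := rfl
  rw [h1, h2, adjugate_fin_two]
  simp only [Matrix.trace_fin_two, Matrix.mul_apply, Fin.sum_univ_two, Matrix.of_apply,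
    Matrix.cons_val_zero, Matrix.cons_val_one, Matrix.cons_val']
  ring

theorem trFun_mul (x y : G) : trFun x * trFun y = trFun (x * y) + trFun (x * y⁻¹) := by
  funext ρ
  simpa [trFun] using sl2_trace_mul (ρ x) (ρ y)

theorem trFun_one : trFun (1 : G) = 2 := by
  funext ρ
  simp [trFun]

variable (G) in
/-- The ring of Fricke characters of `G` over `ℚ`: the `ℚ`-linear span of the functions `tr x`,
`x ∈ G`, inside the algebra of all functions `R(G) → ℂ`; it is closed under multiplication. -/
def frickeSubalgebra : Subalgebra ℚ (Reps G → ℂ) :=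
  (Submodule.span ℚ (Set.range (trFun (G := G)))).toSubalgebra
    (by
      have h : (1 : Reps G → ℂ) = (2⁻¹ : ℚ) • trFun (1 : G) := by
        rw [trFun_one]
        funext ρ
        simp [Rat.smul_def]
      rw [h]
      exact Submodule.smul_mem _ _ (Submodule.subset_span ⟨1, rfl⟩))
    (by
      intro a b ha hb
      have hab := Submodule.mul_mem_mul ha hb
      rw [Submodule.span_mul_span] at hab
      refine Submodule.span_le.2 ?_ hab
      rintro _ ⟨_, ⟨x, rfl⟩, _, ⟨y, rfl⟩, rfl⟩
      change trFun x * trFun y ∈ _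
      rw [trFun_mul]
      exact Submodule.add_mem _ (Submodule.subset_span ⟨_, rfl⟩)
        (Submodule.subset_span ⟨_, rfl⟩))

theorem mem_frickeSubalgebra {f : Reps G → ℂ} :
    f ∈ frickeSubalgebra G ↔ f ∈ Submodule.span ℚ (Set.range (trFun (G := G))) := Iff.rfl

variable (G) in
/-- The subalgebra `frickeSubalgebra G` as a commutative ring. -/
def FrickeRing : Type _ := frickeSubalgebra G

instance : CommRing (FrickeRing G) := inferInstanceAs (CommRing (frickeSubalgebra G))

instance : Algebra ℚ (FrickeRing G) := inferInstanceAs (Algebra ℚ (frickeSubalgebra G))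

/-- The Fricke character `tr x` as an element of the ring of Fricke characters. -/
def tr (x : G) : FrickeRing G := ⟨trFun x, Submodule.subset_span ⟨x, rfl⟩⟩

/-- The action of `σ ∈ Aut G` on functions on `R(G)`: `(σ χ)(ρ) = χ(ρ ∘ σ)`. -/
def funAct (σ : MulAut G) : (Reps G → ℂ) →ₐ[ℚ] (Reps G → ℂ) where
  toFun χ ρ := χ (ρ.comp σ.toMonoidHom)
  map_one' := rfl
  map_mul' _ _ := rfl
  map_zero' := rfl
  map_add' _ _ := rfl
  commutes' _ := rfl

theorem funAct_trFun (σ : MulAut G) (x : G) : funAct σ (trFun x) = trFun (σ x) := rfl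

theorem funAct_mem (σ : MulAut G) {f : Reps G → ℂ} (hf : f ∈ frickeSubalgebra G) :
    funAct σ f ∈ frickeSubalgebra G := by
  rw [mem_frickeSubalgebra] at hf ⊢
  induction hf using Submodule.span_induction with
  | mem f hf =>
    obtain ⟨x, rfl⟩ := hf
    exact Submodule.subset_span ⟨σ x, rfl⟩
  | zero => rw [map_zero]; exact Submodule.zero_mem _
  | add f g _ _ hf hg => rw [map_add]; exact Submodule.add_mem _ hf hg
  | smul c f _ hf => rw [map_smul]; exact Submodule.smul_mem _ _ hf

/-- The action of `σ ∈ Aut G` on the ring of Fricke characters; it sends `tr x` to `tr (σ x)`. -/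
def frickeAct (σ : MulAut G) : FrickeRing G →ₐ[ℚ] FrickeRing G :=
  ((funAct σ).comp (frickeSubalgebra G).val).codRestrict (frickeSubalgebra G)
    fun f => funAct_mem σ f.2

theorem frickeAct_tr (σ : MulAut G) (x : G) : frickeAct σ (tr x) = tr (σ x) := rfl

variable (G) in
/-- The ring of Fricke characters as a representation of `Aut G` over `ℚ`. -/
def frickeRep : Representation ℚ (MulAut G) (FrickeRing G) where
  toFun σ := (frickeAct σ).toLinearMap
  map_one' := rfl
  map_mul' _ _ := rfl

/-! Trace identities. -/

theorem tr_one : tr (1 : G) = 2 := Subtype.ext trFun_one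

theorem tr_mul (x y : G) : tr x * tr y = tr (x * y) + tr (x * y⁻¹) :=
  Subtype.ext (trFun_mul x y)

theorem tr_comm (x y : G) : tr (x * y) = tr (y * x) := by
  apply Subtype.ext
  funext ρ
  change Matrix.trace (ρ (x * y)).1 = Matrix.trace (ρ (y * x)).1
  rw [map_mul, map_mul]
  exact Matrix.trace_mul_comm (ρ x).1 (ρ y).1

theorem coe_rep_mul (ρ : Reps G) (x y : G) : (ρ (x * y)).1 = (ρ x).1 * (ρ y).1 := by
  rw [map_mul]
  rfl

theorem trFun_swap (x y z : G) : trFun (x * y * z) + trFun (y * x * z) =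
    trFun x * trFun (y * z) + trFun y * trFun (x * z) + trFun z * trFun (x * y)
      - trFun x * trFun y * trFun z := by
  funext ρ
  simp only [trFun, Pi.add_apply, Pi.sub_apply, Pi.mul_apply, coe_rep_mul,
    Matrix.trace_fin_two, Matrix.mul_apply, Fin.sum_univ_two]
  ring

theorem tr_swap (x y z : G) : tr (x * y * z) + tr (y * x * z) =
    tr x * tr (y * z) + tr y * tr (x * z) + tr z * tr (x * y) - tr x * tr y * tr z :=
  Subtype.ext (trFun_swap x y z)

theorem trFun_four (x y z w : G) : trFun (x * y * z * w) + trFun (x * y * z * w) =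
    trFun x * trFun (y * z * w) + trFun y * trFun (z * w * x) + trFun z * trFun (w * x * y)
      + trFun w * trFun (x * y * z) + trFun (x * y) * trFun (z * w)
      - trFun (x * z) * trFun (y * w) + trFun (x * w) * trFun (y * z)
      - trFun x * trFun y * trFun (z * w) - trFun y * trFun z * trFun (x * w)
      - trFun x * trFun w * trFun (y * z) - trFun z * trFun w * trFun (x * y)
      + trFun x * trFun y * trFun z * trFun w := by
  funext ρ
  simp only [trFun, Pi.add_apply, Pi.sub_apply, Pi.mul_apply, coe_rep_mul,
    Matrix.trace_fin_two, Matrix.mul_apply, Fin.sum_univ_two]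
  ring

theorem tr_four (x y z w : G) : tr (x * y * z * w) + tr (x * y * z * w) =
    tr x * tr (y * z * w) + tr y * tr (z * w * x) + tr z * tr (w * x * y) + tr w * tr (x * y * z)
      + tr (x * y) * tr (z * w) - tr (x * z) * tr (y * w) + tr (x * w) * tr (y * z)
      - tr x * tr y * tr (z * w) - tr y * tr z * tr (x * w) - tr x * tr w * tr (y * z)
      - tr z * tr w * tr (x * y) + tr x * tr y * tr z * tr w :=
  Subtype.ext (trFun_four x y z w)

/-- The action of `Aut G` on the quotient of `G` by a characteristic subgroup. -/
def autQuotient (N : Subgroup G) [N.Characteristic] : MulAut G →* MulAut (G ⧸ N) where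
  toFun σ := QuotientGroup.congr N N σ (Subgroup.characteristic_iff_map_eq.1 inferInstance σ)
  map_one' := by
    ext x
    induction x using QuotientGroup.induction_on
    rfl
  map_mul' σ τ := by
    ext x
    induction x using QuotientGroup.induction_on
    rfl

variable (G) in
/-- The `k`-th term `A_G(k)` of the Andreadakis–Johnson filtration: the kernel of
`Aut G → Aut (G / Γ_G(k + 1))`. With `Γ_G(1) = G`, the subgroup `Γ_G(k + 1)` is
`(⊤ : Subgroup G).lowerCentralSeries k`. -/
def andreadakisJohnson (k : ℕ) : Subgroup (MulAut G) :=
  (autQuotient ((⊤ : Subgroup G).lowerCentralSeries k)).ker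

end General

section Free

variable (n : ℕ)

/-- The elements `tr (x_{i₁} ⋯ x_{i_l}) - 2` with `1 ≤ l ≤ 3` and `i₁ < ⋯ < i_l`. -/
def genSet : Set (FrickeRing (FreeGroup (Fin n))) :=
  {f | ∃ w : List (Fin n), 1 ≤ w.length ∧ w.length ≤ 3 ∧ w.Pairwise (· < ·) ∧
    f = tr (w.map FreeGroup.of).prod - 2}

/-- The ideal `J` of the ring of Fricke characters of `F_n`. -/
def J : Ideal (FrickeRing (FreeGroup (Fin n))) := Ideal.span (genSet n)

variable {n}

/-- `tr x ≡ 2` modulo `J`. -/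
def IsTwo (x : FreeGroup (Fin n)) : Prop := Ideal.Quotient.mk (J n) (tr x) = 2

theorem IsTwo.comm {x y : FreeGroup (Fin n)} (h : IsTwo (x * y)) : IsTwo (y * x) := by
  unfold IsTwo
  rw [tr_comm]
  exact h

theorem isTwo_one : IsTwo (1 : FreeGroup (Fin n)) := by
  unfold IsTwo
  rw [tr_one, map_ofNat]

theorem IsTwo.mul_iff {x y : FreeGroup (Fin n)} (hx : IsTwo x) (hy : IsTwo y) :
    IsTwo (x * y) ↔ IsTwo (x * y⁻¹) := by
  have h := congrArg (Ideal.Quotient.mk (J n)) (tr_mul x y)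
  unfold IsTwo at *
  rw [map_mul, map_add, hx, hy] at h
  constructor <;> intro h'
  · rw [h'] at h; linear_combination -h
  · rw [h'] at h; linear_combination -h

theorem IsTwo.swap {x y z : FreeGroup (Fin n)} (hx : IsTwo x) (hy : IsTwo y) (hz : IsTwo z)
    (hxy : IsTwo (x * y)) (hxz : IsTwo (x * z)) (hyz : IsTwo (y * z))
    (h : IsTwo (x * y * z)) : IsTwo (y * x * z) := by
  have e := congrArg (Ideal.Quotient.mk (J n)) (tr_swap x y z)
  unfold IsTwo at *
  repeat rw [RingHom.map_add] at e
  repeat rw [RingHom.map_sub] at e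
  repeat rw [RingHom.map_add] at e
  repeat rw [RingHom.map_mul] at e
  rw [hx, hy, hz, hxy, hxz, hyz, h] at e
  linear_combination e

theorem IsTwo.four {x y z w : FreeGroup (Fin n)} (hx : IsTwo x) (hy : IsTwo y) (hz : IsTwo z)
    (hw : IsTwo w) (hxy : IsTwo (x * y)) (hxz : IsTwo (x * z)) (hxw : IsTwo (x * w))
    (hyz : IsTwo (y * z)) (hyw : IsTwo (y * w)) (hzw : IsTwo (z * w)) (h1 : IsTwo (y * z * w))
    (h2 : IsTwo (z * w * x)) (h3 : IsTwo (w * x * y)) (h4 : IsTwo (x * y * z)) :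
    IsTwo (x * y * z * w) := by
  have e := congrArg (Ideal.Quotient.mk (J n)) (tr_four x y z w)
  unfold IsTwo at *
  simp only [RingHom.map_mul, RingHom.map_add, RingHom.map_sub,
    hx, hy, hz, hw, hxy, hxz, hxw, hyz, hyw, hzw, h1, h2, h3, h4] at e
  have h2 : (algebraMap ℚ (FrickeRing (FreeGroup (Fin n)) ⧸ J n) 2⁻¹) * 2 = 1 := by
    rw [← map_ofNat (algebraMap ℚ (FrickeRing (FreeGroup (Fin n)) ⧸ J n)) 2, ← map_mul]
    norm_num
  linear_combination (algebraMap ℚ (FrickeRing (FreeGroup (Fin n)) ⧸ J n) 2⁻¹) * e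
    - (Ideal.Quotient.mk (J n) (tr (x * y * z * w)) - 2) * h2

theorem isTwo_gen (w : List (Fin n)) (h1 : 1 ≤ w.length) (h3 : w.length ≤ 3)
    (hw : w.Pairwise (· < ·)) : IsTwo (w.map FreeGroup.of).prod := by
  have h : tr (w.map FreeGroup.of).prod - 2 ∈ J n := Ideal.subset_span ⟨w, h1, h3, hw, rfl⟩
  have := Ideal.Quotient.eq.2 h
  rwa [map_ofNat] at this

theorem isTwo_length_one (a : Fin n) : IsTwo (FreeGroup.of a) := by
  simpa using isTwo_gen [a] (by simp) (by simp) (by simp)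

theorem isTwo_length_two (a b : Fin n) : IsTwo (FreeGroup.of a * FreeGroup.of b) := by
  rcases lt_trichotomy a b with h | h | h
  · simpa using isTwo_gen [a, b] (by simp) (by simp) (by simp [h])
  · subst h
    rw [IsTwo.mul_iff (isTwo_length_one a) (isTwo_length_one a), mul_inv_cancel]
    exact isTwo_one
  · exact IsTwo.comm (by simpa using isTwo_gen [b, a] (by simp) (by simp) (by simp [h]))

theorem isTwo_rotate {x y z : FreeGroup (Fin n)} (h : IsTwo (x * y * z)) : IsTwo (y * z * x) := by
  rw [mul_assoc] at h
  exact h.comm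

theorem isTwo_transpose {a b c : Fin n}
    (h : IsTwo (FreeGroup.of a * FreeGroup.of b * FreeGroup.of c)) :
    IsTwo (FreeGroup.of b * FreeGroup.of a * FreeGroup.of c) :=
  IsTwo.swap (isTwo_length_one a) (isTwo_length_one b) (isTwo_length_one c)
    (isTwo_length_two a b) (isTwo_length_two a c) (isTwo_length_two b c) h

theorem isTwo_repeat (a c : Fin n) :
    IsTwo (FreeGroup.of a * FreeGroup.of c * FreeGroup.of a) := by
  rw [IsTwo.mul_iff (isTwo_length_two a c) (isTwo_length_one a)]
  apply IsTwo.comm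
  rw [← mul_assoc, inv_mul_cancel, one_mul]
  exact isTwo_length_one c

theorem isTwo_length_three (a b c : Fin n) :
    IsTwo (FreeGroup.of a * FreeGroup.of b * FreeGroup.of c) := by
  have key : ∀ {a b c : Fin n}, a < b → b < c →
      IsTwo (FreeGroup.of a * FreeGroup.of b * FreeGroup.of c) := by
    intro a b c hab hbc
    simpa [mul_assoc] using
      isTwo_gen [a, b, c] (by simp) (by simp) (by simp [hab, hbc, hab.trans hbc])
  rcases lt_trichotomy a b with hab | rfl | hab
  · rcases lt_trichotomy b c with hbc | rfl | hbc
    · exact key hab hbc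
    · exact isTwo_rotate (isTwo_repeat b a)
    · rcases lt_trichotomy a c with hac | rfl | hac
      · exact isTwo_rotate (isTwo_transpose (key hac hbc))
      · exact isTwo_repeat a b
      · exact isTwo_rotate (key hac hab)
  · exact isTwo_rotate (isTwo_rotate (isTwo_repeat a c))
  · rcases lt_trichotomy b c with hbc | rfl | hbc
    · rcases lt_trichotomy a c with hac | rfl | hac
      · exact isTwo_transpose (key hab hac)
      · exact isTwo_repeat a b
      · exact isTwo_rotate (isTwo_rotate (key hbc hac))
    · exact isTwo_rotate (isTwo_repeat b a)
    · exact isTwo_transpose (isTwo_rotate (key hbc hab))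

theorem isTwo_word (w : List (Fin n)) : IsTwo (w.map FreeGroup.of).prod := by
  induction hl : w.length using Nat.strong_induction_on generalizing w with
  | _ m ih =>
    have ih' : ∀ u : List (Fin n), u.length < w.length → IsTwo (u.map FreeGroup.of).prod :=
      fun u hu => ih _ (hl ▸ hu) u rfl
    match w, ih' with
    | [], _ => simpa using isTwo_one
    | [a], _ => simpa using isTwo_length_one a
    | [a, b], _ => simpa using isTwo_length_two a b
    | [a, b, c], _ => simpa [mul_assoc] using isTwo_length_three a b c
    | a :: b :: c :: d :: v, ih' =>
      have hv := ih' (d :: v) (by simp)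
      have h1 := ih' (b :: c :: d :: v) (by simp)
      have h2 := ih' (c :: (d :: v) ++ [a]) (by simp)
      have h3 := ih' ((d :: v) ++ [a, b]) (by simp)
      have h4 := ih' (a :: d :: v) (by simp)
      have h5 := ih' (b :: d :: v) (by simp)
      have h6 := ih' (c :: d :: v) (by simp)
      have := IsTwo.four (isTwo_length_one a) (isTwo_length_one b) (isTwo_length_one c) hv
        (isTwo_length_two a b) (isTwo_length_two a c) (by simpa using h4)
        (isTwo_length_two b c) (by simpa using h5) (by simpa using h6)
        (by simpa [mul_assoc] using h1) (by simpa [mul_assoc] using h2)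
        (by simpa [mul_assoc] using h3) (isTwo_length_three a b c)
      simpa [mul_assoc] using this

theorem isTwo_all (x : FreeGroup (Fin n)) : IsTwo x := by
  have key : ∀ w : List (Fin n), IsTwo (x * (w.map FreeGroup.of).prod) := by
    have hx : x ∈ Subgroup.closure (Set.range (FreeGroup.of (α := Fin n))) := by
      rw [FreeGroup.closure_range_of]
      trivial
    induction hx using Subgroup.closure_induction_right with
    | one => intro w; rw [one_mul]; exact isTwo_word w
    | mul_right x hx y hy ih =>
      obtain ⟨a, rfl⟩ := hy
      intro w
      simpa [mul_assoc] using ih (a :: w)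
    | mul_inv_cancel x hx y hy ih =>
      obtain ⟨a, rfl⟩ := hy
      intro w
      apply IsTwo.comm
      rw [← mul_assoc, ← IsTwo.mul_iff (ih w).comm (isTwo_length_one a), mul_assoc]
      apply IsTwo.comm
      simpa [mul_assoc] using ih (a :: w)
  simpa using key []

/-- `J` contains `tr x - 2` for every `x`. -/
theorem tr_sub_two_mem_J (x : FreeGroup (Fin n)) : tr x - 2 ∈ J n := by
  apply Ideal.Quotient.eq.1
  rw [map_ofNat]
  exact isTwo_all x

/-- The powers of `J` are stable under `Aut F_n`. -/
theorem J_pow_invariant (k : ℕ) (σ : MulAut (FreeGroup (Fin n)))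
    {f : FrickeRing (FreeGroup (Fin n))} (hf : f ∈ J n ^ k) : frickeAct σ f ∈ J n ^ k := by
  have h1 : (J n).map (frickeAct σ) ≤ J n := by
    rw [J, Ideal.map_span, Ideal.span_le]
    rintro _ ⟨_, ⟨w, -, -, -, rfl⟩, rfl⟩
    rw [map_sub, frickeAct_tr, map_ofNat]
    exact tr_sub_two_mem_J _
  have h2 := Ideal.mem_map_of_mem (frickeAct σ) hf
  rw [Ideal.map_pow] at h2
  exact Ideal.pow_right_mono h1 k h2

variable (n)

/-- The power `J ^ k` as a `ℚ`-subspace of the ring of Fricke characters. -/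
def JPow (k : ℕ) : Submodule ℚ (FrickeRing (FreeGroup (Fin n))) := (J n ^ k).restrictScalars ℚ

/-- The action of `Aut F_n` on `J`. -/
def actJ : Representation ℚ (MulAut (FreeGroup (Fin n))) (JPow n 1) :=
  (frickeRep (FreeGroup (Fin n))).subrepresentation (JPow n 1)
    fun σ _ hf => J_pow_invariant 1 σ hf

/-- The induced action of `Aut F_n` on `J / J ^ (k + 1)`. -/
def actJQuotient (k : ℕ) : Representation ℚ (MulAut (FreeGroup (Fin n)))
    (JPow n 1 ⧸ (JPow n (k + 1)).submoduleOf (JPow n 1)) :=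
  (actJ n).quotient ((JPow n (k + 1)).submoduleOf (JPow n 1))
    fun σ _ hf => J_pow_invariant (k + 1) σ hf

/-- `E_{F_n}(k)`: the automorphisms of `F_n` that act trivially on `J / J ^ (k + 1)`. -/
def E (k : ℕ) : Subgroup (MulAut (FreeGroup (Fin n))) :=
  (actJQuotient n k).ker

end Free

end Fricke

end

noncomputable section

namespace Fricke

open Matrix
open scoped commutatorElement

/-! ### Inner automorphisms and `andreadakisJohnson _ 2` act trivially on `J / J²`. -/

section Trivial

variable {n : ℕ}

/-! Since traces span the ring, `E n 1` consists of the automorphisms fixing every `tr x` modulo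
`J²`.

For the inclusion of the product in `E n 1`, conjugation fixes all traces. Modulo `J²` products of
traces become linear, so the identity for `tr (x y z w)` makes `tr (x y z) - tr (y x z)` additive in
`x`. It therefore vanishes for `x` in the commutator subgroup, and multiplication by `Γ(3)` leaves
traces unchanged modulo `J²` (`trMod_lowerCentralSeries_mul`).

For the converse, test on representations into `SL(2, ℂ[X])` congruent to `1` modulo `X`. There `tr
- 2` is divisible by `X²`, so `J²` lands in multiples of `X⁴`, and an element `σ` of `E n 1`
preserves trace coefficients up to `X³` (`trace_matCoeff_eq`). The coefficient of `X²` is a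
quadratic form in the exponent sums, which forces `σ` to act by a sign on the abelianization. The
coefficient of `X³` contains the alternating form `tr ([A, B] C)` of first order parts; it is odd,
so three generators rule out the sign `-1` (`expSum_eq`).

Now `σ(x_i) x_i⁻¹` is a product of commutators `[x_k, x_l]` modulo `Γ(3)`. The `X³` coefficients for
`x_i` and `x_i x_j` leave only the `[x_l, x_i]`, with exponents `μ_l` independent of `i`. With `h`
of exponent sums `μ_l`, this gives `σ(x_i) ≡ [h, x_i] x_i = h x_i h⁻¹`, so `σ` is inner modulo
`Γ(3)`. -/

/-- Induction on elements of the ring of Fricke characters, which is spanned by the `tr x`. -/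
@[elab_as_elim]
theorem frickeRing_induction {G : Type*} [Group G] {p : FrickeRing G → Prop} (f : FrickeRing G)
    (tr : ∀ x, p (tr x)) (add : ∀ f g, p f → p g → p (f + g))
    (smul : ∀ (c : ℚ) f, p f → p (c • f)) : p f := by
  obtain ⟨f, hf⟩ := f
  have hf' := mem_frickeSubalgebra.1 hf
  induction hf' using Submodule.span_induction with
  | mem f hf' =>
    obtain ⟨x, rfl⟩ := hf'
    exact tr x
  | zero =>
    have h := smul 0 _ (tr 1)
    rw [zero_smul] at h
    exact h
  | add f g hf' hg' ihf ihg => exact add ⟨f, hf'⟩ ⟨g, hg'⟩ (ihf hf') (ihg hg')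
  | smul c f hf' ih => exact smul c ⟨f, hf'⟩ (ih hf')

/-- The kernel `E_{F_n}(1)` consists of the automorphisms that fix every `tr x` modulo `J²`. -/
theorem mem_E_one_iff (σ : MulAut (FreeGroup (Fin n))) :
    σ ∈ E n 1 ↔ ∀ x, tr (σ x) - tr x ∈ J n ^ 2 := by
  constructor
  · intro h x
    have hx : tr x - 2 ∈ JPow n 1 := by
      change _ ∈ J n ^ 1
      rw [pow_one]
      exact tr_sub_two_mem_J x
    have h1 := LinearMap.congr_fun (MonoidHom.mem_ker.1 h) (Submodule.Quotient.mk ⟨_, hx⟩)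
    have h2 : frickeAct σ (tr x - 2) - (tr x - 2) ∈ J n ^ 2 :=
      (Submodule.Quotient.eq ((JPow n 2).submoduleOf (JPow n 1))).1 h1
    rw [map_sub, frickeAct_tr, map_ofNat] at h2
    simpa using h2
  · intro h
    have key : ∀ f : FrickeRing (FreeGroup (Fin n)), frickeAct σ f - f ∈ J n ^ 2 := by
      intro f
      induction f using frickeRing_induction with
      | tr x => exact h x
      | add f g hf hg =>
        rw [map_add, add_sub_add_comm]
        exact Submodule.add_mem _ hf hg
      | smul c f hf =>
        rw [map_smul, ← smul_sub]
        exact Submodule.smul_of_tower_mem _ c hf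
    refine MonoidHom.mem_ker.2 (LinearMap.ext fun v => ?_)
    induction v using Submodule.Quotient.induction_on with
    | _ f => exact (Submodule.Quotient.eq _).2 (key f.1)

/-- The class of `tr x` modulo `J²`. -/
def trMod (x : FreeGroup (Fin n)) : FrickeRing (FreeGroup (Fin n)) ⧸ J n ^ 2 :=
  Ideal.Quotient.mk _ (tr x)

theorem trMod_eq_iff {x y : FreeGroup (Fin n)} : trMod x = trMod y ↔ tr x - tr y ∈ J n ^ 2 :=
  Ideal.Quotient.eq

theorem trMod_comm (x y : FreeGroup (Fin n)) : trMod (x * y) = trMod (y * x) :=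
  congrArg (Ideal.Quotient.mk (J n ^ 2)) (tr_comm x y)

theorem trMod_rotate (x y z : FreeGroup (Fin n)) : trMod (x * y * z) = trMod (y * z * x) := by
  rw [mul_assoc, trMod_comm]

/-- This is `(tr x - 2)(tr y - 2) ∈ J²` expanded; it linearizes every product of traces modulo `J²`.
-/
theorem trMod_mul (x y : FreeGroup (Fin n)) :
    trMod x * trMod y = 2 * trMod x + 2 * trMod y - 4 := by
  have h : (tr x - 2) * (tr y - 2) ∈ J n ^ 2 := by
    rw [pow_two]
    exact Ideal.mul_mem_mul (tr_sub_two_mem_J x) (tr_sub_two_mem_J y)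
  have h' := Ideal.Quotient.eq_zero_iff_mem.2 h
  rw [map_mul, map_sub, map_sub, map_ofNat] at h'
  change (trMod x - 2) * (trMod y - 2) = 0 at h'
  linear_combination h'

theorem trMod_mul₃ (x y z : FreeGroup (Fin n)) :
    trMod x * trMod y * trMod z = 4 * (trMod x + trMod y + trMod z) - 16 := by
  linear_combination trMod z * trMod_mul x y + 2 * trMod_mul x z + 2 * trMod_mul y z

theorem trMod_mul₄ (x y z w : FreeGroup (Fin n)) :
    trMod x * trMod y * trMod z * trMod w =
      8 * (trMod x + trMod y + trMod z + trMod w) - 48 := by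
  linear_combination trMod w * trMod_mul₃ x y z +
    4 * (trMod_mul x w + trMod_mul y w + trMod_mul z w)

theorem two_mul_cancel_mod {a b : FrickeRing (FreeGroup (Fin n)) ⧸ J n ^ 2}
    (h : 2 * a = 2 * b) : a = b := by
  have h2 : (algebraMap ℚ (FrickeRing (FreeGroup (Fin n)) ⧸ J n ^ 2) 2⁻¹) * 2 = 1 := by
    rw [← map_ofNat (algebraMap ℚ (FrickeRing (FreeGroup (Fin n)) ⧸ J n ^ 2)) 2, ← map_mul]
    norm_num
  linear_combination (algebraMap ℚ (FrickeRing (FreeGroup (Fin n)) ⧸ J n ^ 2) 2⁻¹) * h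
    - (a - b) * h2

theorem trMod_four (x y z w : FreeGroup (Fin n)) : trMod (x * y * z * w) =
    trMod (y * z * w) + trMod (z * w * x) + trMod (w * x * y) + trMod (x * y * z)
      - trMod (x * y) - trMod (z * w) - trMod (x * w) - trMod (y * z) - trMod (x * z)
      - trMod (y * w) + trMod x + trMod y + trMod z + trMod w - 2 := by
  have e := congrArg (Ideal.Quotient.mk (J n ^ 2)) (tr_four x y z w)
  simp only [RingHom.map_mul, RingHom.map_add, RingHom.map_sub] at e
  change trMod _ + trMod _ = trMod _ * trMod _ + trMod _ * trMod _ + trMod _ * trMod _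
    + trMod _ * trMod _ + trMod _ * trMod _ - trMod _ * trMod _ + trMod _ * trMod _
    - trMod _ * trMod _ * trMod _ - trMod _ * trMod _ * trMod _ - trMod _ * trMod _ * trMod _
    - trMod _ * trMod _ * trMod _ + trMod _ * trMod _ * trMod _ * trMod _ at e
  rw [trMod_mul₄, trMod_mul₃ x y, trMod_mul₃ y z, trMod_mul₃ x w, trMod_mul₃ z w] at e
  simp only [trMod_mul] at e
  -- The trace identity only yields twice the trace of the fourfold product; `2` is invertible over
  -- `ℚ`.
  apply two_mul_cancel_mod
  linear_combination e

/-- The defect of symmetry of `tr (x y z)` modulo `J²`. -/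
def trDefect (x y z : FreeGroup (Fin n)) : FrickeRing (FreeGroup (Fin n)) ⧸ J n ^ 2 :=
  trMod (x * y * z) - trMod (y * x * z)

/-- Subtract `trMod_four` for `(z, x, y, w)` from that for `(x, y, z, w)`: single and double terms
cancel, and the triple terms regroup after cyclic rotation. -/
theorem trDefect_mul (x y z w : FreeGroup (Fin n)) :
    trDefect (x * y) z w = trDefect x z w + trDefect y z w := by
  unfold trDefect
  have h1 := trMod_four x y z w
  have h2 := trMod_four z x y w
  simp only [← mul_assoc] at *
  rw [h1, h2, trMod_comm z x, trMod_comm z y, trMod_rotate x z w, trMod_rotate z x w,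
    trMod_rotate x w z, trMod_rotate z y w, trMod_rotate w x y, trMod_rotate z x y]
  ring

/-- Additivity makes the defect a homomorphism in `x` to an abelian group, so it kills commutators.
-/
theorem trDefect_eq_zero {x : FreeGroup (Fin n)} (hx : x ∈ commutator (FreeGroup (Fin n)))
    (y z : FreeGroup (Fin n)) : trDefect x y z = 0 := by
  let f : FreeGroup (Fin n) →* Multiplicative (FrickeRing (FreeGroup (Fin n)) ⧸ J n ^ 2) :=
    MonoidHom.mk' (fun x => Multiplicative.ofAdd (trDefect x y z)) fun a b => by
      rw [trDefect_mul, ofAdd_add]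
  exact Abelianization.commutator_subset_ker f hx

/-- Multiplication by elements of `Γ(3)` does not change `tr` modulo `J²`. -/
theorem trMod_lowerCentralSeries_mul {g : FreeGroup (Fin n)}
    (hg : g ∈ (⊤ : Subgroup (FreeGroup (Fin n))).lowerCentralSeries 2) :
    ∀ z, trMod (g * z) = trMod z := by
  rw [Subgroup.mem_lowerCentralSeries_succ_iff, Subgroup.top_lowerCentralSeries_one] at hg
  induction hg using Subgroup.closure_induction with
  | mem g hg =>
    obtain ⟨x, hx, y, -, rfl⟩ := hg
    intro z
    -- The third argument is chosen so that the two products compared are `⁅x, y⁆ * z` and `z`.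
    have h := trDefect_eq_zero hx y (x⁻¹ * y⁻¹ * z)
    have e1 : ⁅x, y⁆ * z = x * y * (x⁻¹ * y⁻¹ * z) := by
      rw [commutatorElement_def]; group
    have e2 : z = y * x * (x⁻¹ * y⁻¹ * z) := by group
    rw [e1]
    conv_rhs => rw [e2]
    exact sub_eq_zero.1 h
  | one => simp
  | mul x y _ _ hx hy => intro z; rw [mul_assoc, hx, hy]
  | inv x _ hx => intro z; rw [← hx, mul_inv_cancel_left]

theorem andreadakisJohnson_two_le : andreadakisJohnson (FreeGroup (Fin n)) 2 ≤ E n 1 := by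
  intro σ hσ
  rw [mem_E_one_iff]
  intro x
  rw [← trMod_eq_iff]
  have h := DFunLike.congr_fun (MonoidHom.mem_ker.1 hσ) (QuotientGroup.mk x)
  have h' : (QuotientGroup.mk (σ x) : _ ⧸ (⊤ : Subgroup (FreeGroup (Fin n))).lowerCentralSeries 2)
    = QuotientGroup.mk x := h
  have h2 := (QuotientGroup.eq_iff_div_mem).1 h'
  have h3 := trMod_lowerCentralSeries_mul h2 x
  rwa [div_mul_cancel] at h3

theorem conj_range_le :
    (MulAut.conj : FreeGroup (Fin n) →* MulAut (FreeGroup (Fin n))).range ≤ E n 1 := by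
  rintro _ ⟨h, rfl⟩
  rw [mem_E_one_iff]
  intro x
  rw [MulAut.conj_apply, mul_assoc, tr_comm, inv_mul_cancel_right, sub_self]
  exact Submodule.zero_mem _

end Trivial

/-! ### Polynomial families of representations and orders of vanishing. -/

section PolynomialRep

open Polynomial

theorem mul_coeff_two {R : Type*} [Semiring R] (p q : R[X]) : (p * q).coeff 2 =
    p.coeff 0 * q.coeff 2 + p.coeff 1 * q.coeff 1 + p.coeff 2 * q.coeff 0 := by
  rw [coeff_mul]
  simp [Finset.Nat.antidiagonal_succ, add_assoc]

theorem mul_coeff_three {R : Type*} [Semiring R] (p q : R[X]) : (p * q).coeff 3 =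
    p.coeff 0 * q.coeff 3 + p.coeff 1 * q.coeff 2 + p.coeff 2 * q.coeff 1 +
      p.coeff 3 * q.coeff 0 := by
  rw [coeff_mul]
  simp [Finset.Nat.antidiagonal_succ, add_assoc]

/-- The `j`-th coefficient of a matrix of polynomials. -/
def matCoeff (j : ℕ) (g : SpecialLinearGroup (Fin 2) ℂ[X]) : Matrix (Fin 2) (Fin 2) ℂ :=
  Matrix.of fun a b => (g.1 a b).coeff j

theorem matCoeff_zero_mul (g h : SpecialLinearGroup (Fin 2) ℂ[X]) :
    matCoeff 0 (g * h) = matCoeff 0 g * matCoeff 0 h := by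
  ext a b
  simp [matCoeff, Matrix.mul_apply, Polynomial.mul_coeff_zero]

theorem matCoeff_one_mul (g h : SpecialLinearGroup (Fin 2) ℂ[X]) :
    matCoeff 1 (g * h) = matCoeff 0 g * matCoeff 1 h + matCoeff 1 g * matCoeff 0 h := by
  ext a b
  change ((g.1 * h.1) a b).coeff 1 = _
  simp only [matCoeff, Matrix.mul_apply, Matrix.add_apply, Matrix.of_apply, Fin.sum_univ_two,
    coeff_add, mul_coeff_one]
  ring

theorem matCoeff_two_mul (g h : SpecialLinearGroup (Fin 2) ℂ[X]) :
    matCoeff 2 (g * h) = matCoeff 0 g * matCoeff 2 h + matCoeff 1 g * matCoeff 1 h +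
      matCoeff 2 g * matCoeff 0 h := by
  ext a b
  change ((g.1 * h.1) a b).coeff 2 = _
  simp only [matCoeff, Matrix.mul_apply, Matrix.add_apply, Matrix.of_apply, Fin.sum_univ_two,
    coeff_add, mul_coeff_two]
  ring

theorem matCoeff_three_mul (g h : SpecialLinearGroup (Fin 2) ℂ[X]) :
    matCoeff 3 (g * h) = matCoeff 0 g * matCoeff 3 h + matCoeff 1 g * matCoeff 2 h +
      matCoeff 2 g * matCoeff 1 h + matCoeff 3 g * matCoeff 0 h := by
  ext a b
  change ((g.1 * h.1) a b).coeff 3 = _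
  simp only [matCoeff, Matrix.mul_apply, Matrix.add_apply, Matrix.of_apply, Fin.sum_univ_two,
    coeff_add, mul_coeff_three]
  ring

theorem matCoeff_zero_one : matCoeff 0 1 = 1 := by
  ext a b
  fin_cases a <;> fin_cases b <;> simp [matCoeff]

theorem matCoeff_succ_one (j : ℕ) : matCoeff (j + 1) 1 = 0 := by
  ext a b
  fin_cases a <;> fin_cases b <;> simp [matCoeff, coeff_one]

theorem coeff_trace (j : ℕ) (g : SpecialLinearGroup (Fin 2) ℂ[X]) :
    (Matrix.trace g.1).coeff j = Matrix.trace (matCoeff j g) := by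
  simp [Matrix.trace_fin_two, matCoeff]

theorem coeff_det (j : ℕ) (g : SpecialLinearGroup (Fin 2) ℂ[X]) :
    (g.1 0 0 * g.1 1 1).coeff j - (g.1 0 1 * g.1 1 0).coeff j = (1 : ℂ[X]).coeff j := by
  rw [← coeff_sub, ← Matrix.det_fin_two, g.2]

theorem entry_coeff_zero {g : SpecialLinearGroup (Fin 2) ℂ[X]} (h0 : matCoeff 0 g = 1)
    (a b : Fin 2) : (g.1 a b).coeff 0 = if a = b then 1 else 0 := by
  have := congrFun (congrFun h0 a) b
  simpa [matCoeff, Matrix.one_apply] using this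

theorem trace_matCoeff_one {g : SpecialLinearGroup (Fin 2) ℂ[X]} (h0 : matCoeff 0 g = 1) :
    Matrix.trace (matCoeff 1 g) = 0 := by
  have h := coeff_det 1 g
  simp only [mul_coeff_one, entry_coeff_zero h0] at h
  simpa [Matrix.trace_fin_two, matCoeff, coeff_one, add_comm] using h

/-- Compare coefficients of `X²` in `det g = 1`. -/
theorem trace_matCoeff_two {g : SpecialLinearGroup (Fin 2) ℂ[X]} (h0 : matCoeff 0 g = 1) :
    Matrix.trace (matCoeff 2 g) = - (matCoeff 1 g).det := by
  have h := coeff_det 2 g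
  simp only [mul_coeff_two, entry_coeff_zero h0] at h
  simp [coeff_one] at h
  simp only [Matrix.trace_fin_two, Matrix.det_fin_two, matCoeff, Matrix.of_apply]
  linear_combination h

theorem trace_matCoeff_three {g : SpecialLinearGroup (Fin 2) ℂ[X]} (h0 : matCoeff 0 g = 1)
    (h1 : matCoeff 1 g = 0) : Matrix.trace (matCoeff 3 g) = 0 := by
  have h := coeff_det 3 g
  have h1' : ∀ a b, (g.1 a b).coeff 1 = 0 := fun a b => congrFun (congrFun h1 a) b
  simp only [mul_coeff_three, entry_coeff_zero h0, h1'] at h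
  simp [coeff_one] at h
  simp only [Matrix.trace_fin_two, matCoeff, Matrix.of_apply]
  linear_combination h

/-- The trace of a matrix congruent to `1` modulo `X` is congruent to `2` modulo `X²`. -/
theorem sq_dvd_trace_sub_two {g : SpecialLinearGroup (Fin 2) ℂ[X]} (h0 : matCoeff 0 g = 1) :
    (X : ℂ[X]) ^ 2 ∣ Matrix.trace g.1 - 2 := by
  rw [X_pow_dvd_iff]
  intro d hd
  have h2 : (2 : ℂ[X]) = C 2 := rfl
  rw [coeff_sub, coeff_trace, h2, coeff_C]
  interval_cases d
  · rw [h0]; simp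
  · rw [trace_matCoeff_one h0]; simp

variable {G : Type*} [Group G]

/-- The specialization at `z` of a representation over `ℂ[X]`. -/
def specialize (ρ : G →* SpecialLinearGroup (Fin 2) ℂ[X]) (z : ℂ) : Reps G :=
  (SpecialLinearGroup.map (evalRingHom z)).comp ρ

theorem trFun_specialize (ρ : G →* SpecialLinearGroup (Fin 2) ℂ[X]) (z : ℂ) (x : G) :
    trFun x (specialize ρ z) = (Matrix.trace (ρ x).1).eval z := by
  simp [trFun, specialize, Matrix.trace_fin_two]

/-- The ideal of Fricke characters whose restriction to a polynomial family of representations is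
a polynomial divisible by `X ^ j`. -/
def vanishingIdeal (ρ : G →* SpecialLinearGroup (Fin 2) ℂ[X]) (j : ℕ) : Ideal (FrickeRing G) where
  carrier := {f | ∃ p : ℂ[X], X ^ j ∣ p ∧ ∀ z, f.1 (specialize ρ z) = p.eval z}
  zero_mem' := ⟨0, dvd_zero _, fun z => by rw [eval_zero]; rfl⟩
  add_mem' := by
    rintro f g ⟨p, hp, hf⟩ ⟨q, hq, hg⟩
    refine ⟨p + q, dvd_add hp hq, fun z => ?_⟩
    rw [eval_add, ← hf, ← hg]
    rfl
  smul_mem' := by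
    rintro c f ⟨p, hp, hf⟩
    -- Stability under all multipliers needs each Fricke character to restrict to a polynomial; this
    -- holds for traces, hence for their span.
    have hc : ∃ q : ℂ[X], ∀ z, c.1 (specialize ρ z) = q.eval z := by
      induction c using frickeRing_induction with
      | tr x => exact ⟨_, fun z => trFun_specialize ρ z x⟩
      | add f g hf hg =>
        obtain ⟨p, hp⟩ := hf
        obtain ⟨q, hq⟩ := hg
        refine ⟨p + q, fun z => ?_⟩
        rw [eval_add, ← hp, ← hq]
        rfl
      | smul c f hf =>
        obtain ⟨p, hp⟩ := hf
        refine ⟨c • p, fun z => ?_⟩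
        rw [eval_smul, ← hp]
        rfl
    obtain ⟨q, hq⟩ := hc
    refine ⟨q * p, dvd_mul_of_dvd_right hp q, fun z => ?_⟩
    rw [eval_mul, ← hf, ← hq]
    rfl

theorem vanishingIdeal_mul_le (ρ : G →* SpecialLinearGroup (Fin 2) ℂ[X]) (i j : ℕ) :
    vanishingIdeal ρ i * vanishingIdeal ρ j ≤ vanishingIdeal ρ (i + j) := by
  rw [Ideal.mul_le]
  rintro f ⟨p, hp, hf⟩ g ⟨q, hq, hg⟩
  refine ⟨p * q, by rw [pow_add]; exact mul_dvd_mul hp hq, fun z => ?_⟩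
  rw [eval_mul, ← hf, ← hg]
  rfl

theorem J_le_vanishingIdeal {n : ℕ} {ρ : FreeGroup (Fin n) →* SpecialLinearGroup (Fin 2) ℂ[X]}
    (hρ : ∀ x, matCoeff 0 (ρ x) = 1) : J n ≤ vanishingIdeal ρ 2 := by
  rw [J, Ideal.span_le]
  rintro _ ⟨w, -, -, -, rfl⟩
  refine ⟨_, sq_dvd_trace_sub_two (hρ (w.map FreeGroup.of).prod), fun z => ?_⟩
  rw [eval_sub, ← trFun_specialize]
  simp only [eval_ofNat]
  rfl

/-- An automorphism acting trivially on `J / J²` preserves the traces of polynomial families of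
representations modulo `X⁴`. -/
theorem trace_matCoeff_eq {n : ℕ} {σ : MulAut (FreeGroup (Fin n))} (hσ : σ ∈ E n 1)
    {ρ : FreeGroup (Fin n) →* SpecialLinearGroup (Fin 2) ℂ[X]}
    (hρ : ∀ x, matCoeff 0 (ρ x) = 1) (x : FreeGroup (Fin n)) {j : ℕ} (hj : j < 4) :
    Matrix.trace (matCoeff j (ρ (σ x))) = Matrix.trace (matCoeff j (ρ x)) := by
  have h1 := (mem_E_one_iff σ).1 hσ x
  have h2 : J n ^ 2 ≤ vanishingIdeal ρ 4 := by
    rw [pow_two]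
    exact (Ideal.mul_mono (J_le_vanishingIdeal hρ) (J_le_vanishingIdeal hρ)).trans
      (vanishingIdeal_mul_le ρ 2 2)
  obtain ⟨p, hp, h⟩ := h2 h1
  -- A complex polynomial is determined by its values, so `p` is the expected trace difference.
  have hpe : p = Matrix.trace (ρ (σ x)).1 - Matrix.trace (ρ x).1 := by
    refine Polynomial.funext fun z => ?_
    rw [eval_sub, ← trFun_specialize, ← trFun_specialize, ← h z]
    rfl
  have h3 := X_pow_dvd_iff.1 hp j hj
  rw [hpe, coeff_sub, coeff_trace, coeff_trace] at h3
  exact sub_eq_zero.1 h3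

end PolynomialRep

/-! ### Exponent sums as coordinates on the abelianization. -/

section Exponents

variable {n : ℕ}

/-- The exponent sum of the generator `x_k` in `x`. -/
def expSum (k : Fin n) (x : FreeGroup (Fin n)) : ℤ :=
  Multiplicative.toAdd
    (FreeGroup.lift (fun i => Multiplicative.ofAdd (if i = k then (1 : ℤ) else 0)) x)

theorem expSum_of (k i : Fin n) : expSum k (FreeGroup.of i) = if i = k then 1 else 0 := by
  simp [expSum]

theorem expSum_mul (k : Fin n) (x y : FreeGroup (Fin n)) :
    expSum k (x * y) = expSum k x + expSum k y := by
  simp [expSum]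

theorem expSum_inv (k : Fin n) (x : FreeGroup (Fin n)) : expSum k x⁻¹ = - expSum k x := by
  simp [expSum]

/-- Additive maps on a free group are determined by their values on the generators. -/
theorem eq_sum_expSum_smul {M : Type*} [AddCommGroup M] (f : FreeGroup (Fin n) → M)
    (hf : ∀ x y, f (x * y) = f x + f y) (x : FreeGroup (Fin n)) :
    f x = ∑ k, expSum k x • f (FreeGroup.of k) := by
  let φ : FreeGroup (Fin n) →* Multiplicative M :=
    MonoidHom.mk' (fun x => Multiplicative.ofAdd (f x)) fun a b => by rw [hf, ofAdd_add]
  let ψ : FreeGroup (Fin n) →* Multiplicative M :=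
    MonoidHom.mk' (fun x => Multiplicative.ofAdd (∑ k, expSum k x • f (FreeGroup.of k)))
      fun a b => by simp only [expSum_mul, add_smul, Finset.sum_add_distrib, ofAdd_add]
  have h : φ = ψ := by
    refine FreeGroup.ext_hom _ _ fun i => ?_
    change Multiplicative.ofAdd (f (FreeGroup.of i)) = Multiplicative.ofAdd _
    simp [expSum_of]
  exact congrArg Multiplicative.toAdd (DFunLike.congr_fun h x)

theorem eq_sum_sum_expSum_smul {M : Type*} [AddCommGroup M]
    (f : FreeGroup (Fin n) → FreeGroup (Fin n) → M)
    (hl : ∀ x y z, f (x * y) z = f x z + f y z) (hr : ∀ x y z, f x (y * z) = f x y + f x z)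
    (x y : FreeGroup (Fin n)) :
    f x y = ∑ k, ∑ l, (expSum k x * expSum l y) • f (FreeGroup.of k) (FreeGroup.of l) := by
  rw [eq_sum_expSum_smul (fun x => f x y) (fun a b => hl a b y)]
  refine Finset.sum_congr rfl fun k _ => ?_
  rw [eq_sum_expSum_smul (f (FreeGroup.of k)) (hr _), Finset.smul_sum]
  simp only [mul_smul]

theorem mem_commutator_of_expSum_eq_zero {x : FreeGroup (Fin n)} (h : ∀ k, expSum k x = 0) :
    x ∈ commutator (FreeGroup (Fin n)) := by
  have e := eq_sum_expSum_smul
    (fun x => Additive.ofMul (Abelianization.of x)) (fun x y => by rw [map_mul, ofMul_mul]) x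
  simp only [h, zero_smul, Finset.sum_const_zero] at e
  rw [← Abelianization.ker_of]
  exact e

end Exponents

/-! ### Commutators modulo `Γ(3)`. -/

section ClassTwo

variable {G : Type*} [Group G]

/-- Commutators modulo `Γ(3)` are central, so the center serves as an abelian target in which they
are biadditive. -/
instance centerCommGroup (Q : Type*) [Group Q] : CommGroup (Subgroup.center Q) :=
  { (inferInstance : Group (Subgroup.center Q)) with
    mul_comm := fun a b => Subtype.ext (Subgroup.mem_center_iff.1 b.2 a.1) }

theorem commutator_mem_center (x y : G) :
    (QuotientGroup.mk ⁅x, y⁆ : G ⧸ (⊤ : Subgroup G).lowerCentralSeries 2) ∈ Subgroup.center _ := by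
  rw [Subgroup.mem_center_iff]
  intro z
  induction z using QuotientGroup.induction_on with
  | _ z =>
    have h : ⁅⁅x, y⁆, z⁆ ∈ (⊤ : Subgroup G).lowerCentralSeries 2 :=
      Subgroup.commutator_mem_commutator
        (Subgroup.commutator_mem_commutator (Subgroup.mem_top x) (Subgroup.mem_top y))
        (Subgroup.mem_top z)
    rw [← QuotientGroup.mk_mul, ← QuotientGroup.mk_mul, eq_comm, QuotientGroup.eq_iff_div_mem]
    convert h using 1
    rw [commutatorElement_def ⁅x, y⁆ z, div_eq_mul_inv]
    group

/-- The commutator of `x` and `y` modulo `Γ(3)`. -/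
def commMod (x y : G) :
    Additive (Subgroup.center (G ⧸ (⊤ : Subgroup G).lowerCentralSeries 2)) :=
  Additive.ofMul ⟨_, commutator_mem_center x y⟩

theorem coe_commMod (x y : G) : ((commMod x y).toMul : G ⧸ (⊤ : Subgroup G).lowerCentralSeries 2) =
    QuotientGroup.mk ⁅x, y⁆ := rfl

theorem commMod_mul_left (x y z : G) : commMod (x * y) z = commMod x z + commMod y z := by
  apply Additive.toMul.injective
  apply Subtype.ext
  rw [toMul_add, Subgroup.coe_mul, coe_commMod, coe_commMod, coe_commMod]
  have h := Subgroup.mem_center_iff.1 (commutator_mem_center y z) (QuotientGroup.mk x)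
  have e : ⁅x * y, z⁆ = x * ⁅y, z⁆ * (z * x⁻¹ * z⁻¹) := by
    simp only [commutatorElement_def]; group
  rw [e, QuotientGroup.mk_mul, QuotientGroup.mk_mul, h, mul_assoc, ← QuotientGroup.mk_mul]
  have e2 : x * (z * x⁻¹ * z⁻¹) = ⁅x, z⁆ := by simp only [commutatorElement_def]; group
  rw [e2, ← Subgroup.mem_center_iff.1 (commutator_mem_center y z)]

theorem commMod_swap (x y : G) : commMod x y = - commMod y x := by
  apply Additive.toMul.injective
  apply Subtype.ext
  rw [toMul_neg, Subgroup.coe_inv, coe_commMod, coe_commMod, ← QuotientGroup.mk_inv,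
    commutatorElement_inv]

theorem commMod_mul_right (x y z : G) : commMod x (y * z) = commMod x y + commMod x z := by
  rw [commMod_swap, commMod_mul_left, commMod_swap y x, commMod_swap z x]
  abel

theorem commMod_self (x : G) : commMod x x = 0 := by
  apply Additive.toMul.injective
  apply Subtype.ext
  rw [coe_commMod, commutatorElement_self]
  rfl

end ClassTwo

/-! ### Low order coefficients of products and commutators. -/

section Infinitesimal

open Polynomial

variable {G : Type*} [Group G] {ρ : G →* SpecialLinearGroup (Fin 2) ℂ[X]}

theorem matCoeff_one_rep_mul (hρ : ∀ x, matCoeff 0 (ρ x) = 1) (x y : G) :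
    matCoeff 1 (ρ (x * y)) = matCoeff 1 (ρ x) + matCoeff 1 (ρ y) := by
  rw [map_mul, matCoeff_one_mul, hρ, hρ, one_mul, mul_one, add_comm]

theorem matCoeff_two_rep_mul (hρ : ∀ x, matCoeff 0 (ρ x) = 1) (x y : G) :
    matCoeff 2 (ρ (x * y)) =
      matCoeff 2 (ρ x) + matCoeff 2 (ρ y) + matCoeff 1 (ρ x) * matCoeff 1 (ρ y) := by
  rw [map_mul, matCoeff_two_mul, hρ, hρ, one_mul, mul_one]
  abel

theorem matCoeff_three_rep_mul (hρ : ∀ x, matCoeff 0 (ρ x) = 1) (x y : G) :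
    matCoeff 3 (ρ (x * y)) = matCoeff 3 (ρ x) + matCoeff 3 (ρ y) +
      matCoeff 1 (ρ x) * matCoeff 2 (ρ y) + matCoeff 2 (ρ x) * matCoeff 1 (ρ y) := by
  rw [map_mul, matCoeff_three_mul, hρ, hρ, one_mul, mul_one]
  abel

theorem matCoeff_one_rep_commutator (hρ : ∀ x, matCoeff 0 (ρ x) = 1) (x y : G) :
    matCoeff 1 (ρ ⁅x, y⁆) = 0 := by
  have h : ⁅x, y⁆ * (y * x) = x * y := by rw [commutatorElement_def]; group
  have h1 := congrArg (fun g => matCoeff 1 (ρ g)) h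
  simp only [matCoeff_one_rep_mul hρ] at h1
  rw [add_comm (matCoeff 1 (ρ y))] at h1
  exact add_eq_right.1 h1

theorem matCoeff_two_rep_commutator (hρ : ∀ x, matCoeff 0 (ρ x) = 1) (x y : G) :
    matCoeff 2 (ρ ⁅x, y⁆) =
      matCoeff 1 (ρ x) * matCoeff 1 (ρ y) - matCoeff 1 (ρ y) * matCoeff 1 (ρ x) := by
  have h : ⁅x, y⁆ * (y * x) = x * y := by rw [commutatorElement_def]; group
  have h1 := congrArg (fun g => matCoeff 2 (ρ g)) h
  simp only [matCoeff_two_rep_mul hρ, matCoeff_one_rep_commutator hρ, zero_mul, add_zero] at h1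
  rw [eq_sub_iff_add_eq, ← add_left_inj (matCoeff 2 (ρ x) + matCoeff 2 (ρ y))]
  rw [add_comm (matCoeff 1 (ρ x) * _), ← h1]
  abel

/-- The coefficient of `X³` in `tr (x y z) - tr (y x z)`. -/
theorem trace_matCoeff_three_swap (hρ : ∀ x, matCoeff 0 (ρ x) = 1) (x y z : G) :
    Matrix.trace (matCoeff 3 (ρ (x * y * z))) - Matrix.trace (matCoeff 3 (ρ (y * x * z))) =
      Matrix.trace ((matCoeff 1 (ρ x) * matCoeff 1 (ρ y) - matCoeff 1 (ρ y) * matCoeff 1 (ρ x)) *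
        matCoeff 1 (ρ z)) := by
  simp only [matCoeff_three_rep_mul hρ, matCoeff_two_rep_mul hρ, matCoeff_one_rep_mul hρ,
    Matrix.trace_add, Matrix.add_mul, Matrix.sub_mul, Matrix.trace_sub]
  rw [Matrix.trace_mul_comm (matCoeff 1 (ρ x)) (matCoeff 2 (ρ y)),
    Matrix.trace_mul_comm (matCoeff 2 (ρ x)) (matCoeff 1 (ρ y))]
  ring

/-- The coefficient of `X³` in `tr (g x) - tr x` for `g` in the commutator subgroup. -/
theorem trace_matCoeff_three_mul_left (hρ : ∀ x, matCoeff 0 (ρ x) = 1) {g : G}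
    (hg : matCoeff 1 (ρ g) = 0) (x : G) :
    Matrix.trace (matCoeff 3 (ρ (g * x))) = Matrix.trace (matCoeff 3 (ρ x)) +
      Matrix.trace (matCoeff 2 (ρ g) * matCoeff 1 (ρ x)) := by
  rw [matCoeff_three_rep_mul hρ, hg, Matrix.zero_mul, add_zero, Matrix.trace_add, Matrix.trace_add,
    trace_matCoeff_three (hρ g) hg, zero_add]

/-- If `g` is trivial to first order, conjugation changes it only from third order on. -/
theorem matCoeff_conj (hρ : ∀ x, matCoeff 0 (ρ x) = 1) {g : G}
    (hg : matCoeff 1 (ρ g) = 0) (x : G) :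
    matCoeff 1 (ρ (x * g * x⁻¹)) = 0 ∧ matCoeff 2 (ρ (x * g * x⁻¹)) = matCoeff 2 (ρ g) := by
  have h : x * g * x⁻¹ * x = x * g := by group
  have h1 := congrArg (fun g => matCoeff 1 (ρ g)) h
  have h2 := congrArg (fun g => matCoeff 2 (ρ g)) h
  beta_reduce at h1 h2
  rw [matCoeff_one_rep_mul hρ _ x, matCoeff_one_rep_mul hρ x g, hg, add_zero] at h1
  have h1' := add_eq_right.1 h1
  refine ⟨h1', ?_⟩
  rw [matCoeff_two_rep_mul hρ _ x, matCoeff_two_rep_mul hρ x g, hg, h1', Matrix.mul_zero,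
    Matrix.zero_mul, add_zero, add_zero, add_comm] at h2
  exact add_left_cancel h2

end Infinitesimal

/-! ### Expanding elements of the commutator subgroup in basic commutators. -/

section Expansion

open Polynomial

variable {n : ℕ}

/-- The second coefficient of `∏ [x_k, x_l] ^ m_{kl}` under a representation with first order part
`A`. -/
def bracketSum (m : Fin n → Fin n → ℤ) (A : Fin n → Matrix (Fin 2) (Fin 2) ℂ) :
    Matrix (Fin 2) (Fin 2) ℂ :=
  ∑ k, ∑ l, m k l • (A k * A l - A l * A k)

/-- `g` is congruent to `∏ [x_k, x_l] ^ m_{kl}` modulo `Γ(3)`, and correspondingly in every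
polynomial family of representations. -/
structure IsCommExpansion (g : FreeGroup (Fin n)) (m : Fin n → Fin n → ℤ) : Prop where
  mk_eq : QuotientGroup.mk g =
    ((∑ k, ∑ l, m k l • commMod (FreeGroup.of k) (FreeGroup.of l)).toMul :
      FreeGroup (Fin n) ⧸ (⊤ : Subgroup (FreeGroup (Fin n))).lowerCentralSeries 2)
  matCoeff_one : ∀ ρ : FreeGroup (Fin n) →* SpecialLinearGroup (Fin 2) ℂ[X],
    (∀ x, matCoeff 0 (ρ x) = 1) → matCoeff 1 (ρ g) = 0
  matCoeff_two : ∀ ρ : FreeGroup (Fin n) →* SpecialLinearGroup (Fin 2) ℂ[X],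
    (∀ x, matCoeff 0 (ρ x) = 1) →
      matCoeff 2 (ρ g) = bracketSum m fun k => matCoeff 1 (ρ (FreeGroup.of k))

theorem isCommExpansion_commutator (x y : FreeGroup (Fin n)) :
    IsCommExpansion ⁅x, y⁆ fun k l => expSum k x * expSum l y where
  mk_eq := by
    rw [← eq_sum_sum_expSum_smul commMod commMod_mul_left commMod_mul_right, coe_commMod]
  matCoeff_one ρ hρ := matCoeff_one_rep_commutator hρ x y
  matCoeff_two ρ hρ := by
    rw [matCoeff_two_rep_commutator hρ, bracketSum]
    refine eq_sum_sum_expSum_smul (fun x y =>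
      matCoeff 1 (ρ x) * matCoeff 1 (ρ y) - matCoeff 1 (ρ y) * matCoeff 1 (ρ x)) ?_ ?_ x y
    · intro x y z
      simp only [matCoeff_one_rep_mul hρ, Matrix.add_mul, Matrix.mul_add]
      abel
    · intro x y z
      simp only [matCoeff_one_rep_mul hρ, Matrix.add_mul, Matrix.mul_add]
      abel

theorem exists_isCommExpansion {g : FreeGroup (Fin n)} (hg : g ∈ commutator (FreeGroup (Fin n))) :
    ∃ m, IsCommExpansion g m := by
  rw [commutator_eq_closure] at hg
  induction hg using Subgroup.closure_induction with
  | mem g hg =>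
    obtain ⟨x, y, rfl⟩ := hg
    exact ⟨_, isCommExpansion_commutator x y⟩
  | one =>
    refine ⟨0, ?_, fun ρ _ => ?_, fun ρ _ => ?_⟩
    · simp only [Pi.zero_apply, zero_smul, Finset.sum_const_zero]
      rfl
    · rw [map_one, matCoeff_succ_one]
    · rw [map_one, matCoeff_succ_one]
      simp [bracketSum]
  | mul x y _ _ hx hy =>
    obtain ⟨a, ha⟩ := hx
    obtain ⟨b, hb⟩ := hy
    refine ⟨a + b, ?_, fun ρ hρ => ?_, fun ρ hρ => ?_⟩
    · simp only [Pi.add_apply, add_smul, Finset.sum_add_distrib, toMul_add, Subgroup.coe_mul,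
        QuotientGroup.mk_mul, ← ha.mk_eq, ← hb.mk_eq]
    · rw [matCoeff_one_rep_mul hρ, ha.matCoeff_one ρ hρ, hb.matCoeff_one ρ hρ, add_zero]
    · rw [matCoeff_two_rep_mul hρ, ha.matCoeff_one ρ hρ, ha.matCoeff_two ρ hρ, hb.matCoeff_two ρ hρ]
      simp [bracketSum, add_smul, Finset.sum_add_distrib]
  | inv x _ hx =>
    obtain ⟨a, ha⟩ := hx
    refine ⟨-a, ?_, fun ρ hρ => ?_, fun ρ hρ => ?_⟩
    · simp only [Pi.neg_apply, neg_smul, Finset.sum_neg_distrib, toMul_neg, Subgroup.coe_inv,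
        QuotientGroup.mk_inv, ← ha.mk_eq]
    · have h := matCoeff_one_rep_mul hρ x⁻¹ x
      rw [inv_mul_cancel, map_one, matCoeff_succ_one, ha.matCoeff_one ρ hρ, add_zero] at h
      exact h.symm
    · have h := matCoeff_two_rep_mul hρ x⁻¹ x
      rw [inv_mul_cancel, map_one, matCoeff_succ_one, ha.matCoeff_one ρ hρ, ha.matCoeff_two ρ hρ,
        Matrix.mul_zero, add_zero] at h
      rw [eq_neg_of_add_eq_zero_left h.symm]
      simp [bracketSum]

end Expansion

/-! ### Families with arbitrary traceless first order part on each generator. -/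

section Families

open Polynomial

variable {n : ℕ}

/-- A matrix in `SL(2, ℂ[X])`, congruent to `1` modulo `X`, with prescribed first order part. -/
def unipotentProd (a b c : ℂ) : SpecialLinearGroup (Fin 2) ℂ[X] :=
  -- Each factor is `1` plus a multiple of a nilpotent matrix, so has determinant `1`; the three
  -- nilpotents span the traceless matrices.
  ⟨!![1, C a * X; 0, 1] * !![1, 0; C b * X, 1] *
    !![1 + C c * X, -(C c * X); C c * X, 1 - C c * X], by
      rw [Matrix.det_mul, Matrix.det_mul, Matrix.det_fin_two_of, Matrix.det_fin_two_of,
        Matrix.det_fin_two_of]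
      ring⟩

/-- The general traceless `2 × 2` matrix. -/
def traceless (a b c : ℂ) : Matrix (Fin 2) (Fin 2) ℂ := !![c, a - c; b + c, -c]

theorem matCoeff_zero_unipotentProd (a b c : ℂ) : matCoeff 0 (unipotentProd a b c) = 1 := by
  ext i j
  fin_cases i <;> fin_cases j <;> simp [matCoeff, unipotentProd]

theorem matCoeff_one_unipotentProd (a b c : ℂ) :
    matCoeff 1 (unipotentProd a b c) = traceless a b c := by
  ext i j
  fin_cases i <;> fin_cases j <;>
    simp [matCoeff, unipotentProd, traceless, mul_coeff_one, coeff_one]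
  ring

/-- The polynomial family of representations with first order part `traceless (a k) (b k) (c k)`
on the generator `x_k`. -/
def familyRep (a b c : Fin n → ℂ) : FreeGroup (Fin n) →* SpecialLinearGroup (Fin 2) ℂ[X] :=
  FreeGroup.lift fun k => unipotentProd (a k) (b k) (c k)

theorem matCoeff_zero_familyRep (a b c : Fin n → ℂ) (x : FreeGroup (Fin n)) :
    matCoeff 0 (familyRep a b c x) = 1 := by
  induction x using FreeGroup.induction_on with
  | C1 => rw [map_one, matCoeff_zero_one]
  | of k => rw [familyRep, FreeGroup.lift_apply_of, matCoeff_zero_unipotentProd]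
  | inv_of k h =>
    have e := matCoeff_zero_mul (familyRep a b c (FreeGroup.of k)⁻¹)
      (familyRep a b c (FreeGroup.of k))
    rw [← map_mul, inv_mul_cancel, map_one, matCoeff_zero_one, h, mul_one] at e
    exact e.symm
  | mul x y hx hy => rw [map_mul, matCoeff_zero_mul, hx, hy, mul_one]

theorem matCoeff_one_familyRep_of (a b c : Fin n → ℂ) (k : Fin n) :
    matCoeff 1 (familyRep a b c (FreeGroup.of k)) = traceless (a k) (b k) (c k) := by
  rw [familyRep, FreeGroup.lift_apply_of, matCoeff_one_unipotentProd]

theorem matCoeff_one_familyRep (a b c : Fin n → ℂ) (x : FreeGroup (Fin n)) :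
    matCoeff 1 (familyRep a b c x) =
      ∑ k, expSum k x • traceless (a k) (b k) (c k) := by
  rw [eq_sum_expSum_smul (fun x => matCoeff 1 (familyRep a b c x))
    (matCoeff_one_rep_mul (matCoeff_zero_familyRep a b c))]
  simp only [matCoeff_one_familyRep_of]

end Families

/-! ### Action on the abelianization. -/

section Homology

variable {n : ℕ} {σ : MulAut (FreeGroup (Fin n))}

/-- In this family the first order part is off-diagonal with entries the two exponent sums, so minus
its determinant, the `X²` coefficient of the trace, is their product. -/
theorem expSum_mul_expSum (hσ : σ ∈ E n 1) (i j : Fin n) (x : FreeGroup (Fin n)) :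
    expSum i (σ x) * expSum j (σ x) = expSum i x * expSum j x := by
  have hρ := matCoeff_zero_familyRep (Pi.single i 1 : Fin n → ℂ) (Pi.single j 1) 0
  have key : ∀ y, Matrix.trace
      (matCoeff 2 (familyRep (Pi.single i 1 : Fin n → ℂ) (Pi.single j 1) 0 y)) =
      ((expSum i y * expSum j y : ℤ) : ℂ) := by
    intro y
    rw [trace_matCoeff_two (hρ y), matCoeff_one_familyRep, Matrix.det_fin_two]
    simp [Matrix.sum_apply, traceless, Pi.single_apply]
  have h := trace_matCoeff_eq hσ hρ x (j := 2) (by norm_num)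
  rw [key, key] at h
  exact_mod_cast h

/-- An automorphism acting trivially on `J / J²` acts as `± 1` on the abelianization. -/
theorem exists_sign (hσ : σ ∈ E n 1) :
    ∃ ε : ℤ, (ε = 1 ∨ ε = -1) ∧ ∀ i x, expSum i (σ x) = ε * expSum i x := by
  rcases isEmpty_or_nonempty (Fin n) with hn | ⟨⟨k₀⟩⟩
  · exact ⟨1, Or.inl rfl, fun i => hn.elim i⟩
  have h0 : ∀ i k, i ≠ k → expSum i (σ (FreeGroup.of k)) = 0 := by
    intro i k hik
    have h := expSum_mul_expSum hσ i i (FreeGroup.of k)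
    rw [expSum_of, if_neg hik.symm, mul_zero] at h
    exact mul_self_eq_zero.1 h
  have h1 : ∀ k, expSum k (σ (FreeGroup.of k)) * expSum k (σ (FreeGroup.of k)) = 1 := by
    intro k
    rw [expSum_mul_expSum hσ, expSum_of, if_pos rfl, mul_one]
  have h2 : ∀ k, expSum k (σ (FreeGroup.of k)) = expSum k₀ (σ (FreeGroup.of k₀)) := by
    intro k
    by_cases hk : k = k₀
    · rw [hk]
    -- Squares leave a separate sign for each generator; the mixed product at `x_k x_{k₀}` makes the
    -- signs agree.
    have h := expSum_mul_expSum hσ k k₀ (FreeGroup.of k * FreeGroup.of k₀)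
    rw [map_mul] at h
    simp only [expSum_mul, expSum_of, h0 k k₀ hk, h0 k₀ k (Ne.symm hk), if_neg hk,
      if_neg (Ne.symm hk), if_true] at h
    linear_combination expSum k₀ (σ (FreeGroup.of k₀)) * h - expSum k (σ (FreeGroup.of k)) * h1 k₀
  refine ⟨expSum k₀ (σ (FreeGroup.of k₀)), mul_self_eq_one_iff.1 (h1 k₀), fun i x => ?_⟩
  rw [eq_sum_expSum_smul (fun x => expSum i (σ x)) (fun x y => by rw [map_mul, expSum_mul]),
    Finset.sum_eq_single i, h2, smul_eq_mul, mul_comm]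
  · intro k _ hk
    rw [h0 i k hk.symm, smul_zero]
  · simp

/-- An automorphism acting trivially on `J / J²` acts trivially on the abelianization. -/
theorem expSum_eq (hn : 3 ≤ n) (hσ : σ ∈ E n 1) (i : Fin n) (x : FreeGroup (Fin n)) :
    expSum i (σ x) = expSum i x := by
  obtain ⟨ε, rfl | rfl, hε⟩ := exists_sign hσ
  · rw [hε, one_mul]
  exfalso
  let p : Fin n := ⟨0, by omega⟩
  let q : Fin n := ⟨1, by omega⟩
  let r : Fin n := ⟨2, by omega⟩
  have hpq : p ≠ q := by simp [p, q]
  have hpr : p ≠ r := by simp [p, r]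
  have hqr : q ≠ r := by simp [q, r]
  -- The three generators get a basis of the traceless matrices, on which `tr ([A, B] C)` is
  -- nonzero; the sign `-1` would negate this invariant quantity.
  have hρ := matCoeff_zero_familyRep (Pi.single p 1 : Fin n → ℂ) (Pi.single q 1) (Pi.single r 1)
  have hneg : ∀ y, matCoeff 1 (familyRep (Pi.single p 1 : Fin n → ℂ) (Pi.single q 1)
      (Pi.single r 1) (σ y)) =
      - matCoeff 1 (familyRep (Pi.single p 1) (Pi.single q 1) (Pi.single r 1) y) := by
    intro y
    simp only [matCoeff_one_familyRep, hε, neg_mul, one_mul, neg_smul, Finset.sum_neg_distrib]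
  have h := trace_matCoeff_three_swap hρ (σ (FreeGroup.of p)) (σ (FreeGroup.of q))
    (σ (FreeGroup.of r))
  rw [← map_mul σ, ← map_mul σ, ← map_mul σ, ← map_mul σ, trace_matCoeff_eq hσ hρ _ (by norm_num),
    trace_matCoeff_eq hσ hρ _ (by norm_num), trace_matCoeff_three_swap hρ, hneg, hneg, hneg,
    matCoeff_one_familyRep_of, matCoeff_one_familyRep_of, matCoeff_one_familyRep_of] at h
  simp [traceless, hpq, hpr, hqr, hpq.symm, hpr.symm, hqr.symm, Matrix.trace_fin_two] at h
  norm_num at h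

end Homology

/-! ### The class of `σ` modulo `Γ(3)`. -/

section Johnson

variable {n : ℕ}

theorem bracketSum_of_support (m : Fin n → Fin n → ℤ) (i j l : Fin n)
    (P Q R : Matrix (Fin 2) (Fin 2) ℂ) :
    bracketSum m (fun p => (if p = i then P else 0) + (if p = j then Q else 0)
      + (if p = l then R else 0)) =
      (m i j - m j i) • (P * Q - Q * P) + (m i l - m l i) • (P * R - R * P)
        + (m j l - m l j) • (Q * R - R * Q) := by
  simp only [bracketSum, add_mul, mul_add, smul_add, smul_sub, Finset.sum_add_distrib,
    Finset.sum_sub_distrib, ite_mul, mul_ite, zero_mul, mul_zero, smul_ite, smul_zero,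
    Finset.sum_ite_eq', Finset.mem_univ, if_true, Finset.sum_ite_irrel, Finset.sum_const_zero,
    sub_smul]
  abel

theorem traceless_single (i j l p : Fin n) :
    traceless ((Pi.single i 1 : Fin n → ℂ) p) ((Pi.single j 1 : Fin n → ℂ) p)
      ((Pi.single l 1 : Fin n → ℂ) p) =
      (if p = i then traceless 1 0 0 else 0) + (if p = j then traceless 0 1 0 else 0)
        + (if p = l then traceless 0 0 1 else 0) := by
  simp only [Pi.single_apply]
  split_ifs <;> ext a b <;> fin_cases a <;> fin_cases b <;> simp [traceless]

/-- The coefficients of the commutators `[x_j, x_l]` in `σ(x_i) x_i⁻¹` modulo `Γ(3)` vanish for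
`i ≠ j, l`. -/
theorem coeff_eq_of_distinct {σ : MulAut (FreeGroup (Fin n))} (hσ : σ ∈ E n 1)
    {m : Fin n → Fin n → ℤ} {i j l : Fin n} (hij : i ≠ j) (hil : i ≠ l)
    (hm : IsCommExpansion (σ (FreeGroup.of i) * (FreeGroup.of i)⁻¹) m) : m j l = m l j := by
  have hρ := matCoeff_zero_familyRep (Pi.single i 1 : Fin n → ℂ) (Pi.single j 1) (Pi.single l 1)
  have h := trace_matCoeff_three_mul_left hρ (hm.matCoeff_one _ hρ) (FreeGroup.of i)
  rw [inv_mul_cancel_right, trace_matCoeff_eq hσ hρ _ (by norm_num), left_eq_add,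
    hm.matCoeff_two _ hρ] at h
  simp only [matCoeff_one_familyRep_of, traceless_single, bracketSum_of_support] at h
  -- Brackets involving the matrix of `x_i` are trace-orthogonal to that matrix, so only the `[x_j,
  -- x_l]` term survives.
  simp [hij, hil, traceless, Matrix.trace_fin_two] at h
  exact_mod_cast sub_eq_zero.1 h

/-- The exponent of `[x_l, x_i]` in `σ(x_i) x_i⁻¹` does not depend on `i`: by alternation, the `X³`
coefficient at `x_i x_j` is a multiple of the difference of the two exponents. -/
theorem coeff_sub_eq_coeff_sub {σ : MulAut (FreeGroup (Fin n))} (hσ : σ ∈ E n 1)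
    {m : Fin n → Fin n → Fin n → ℤ}
    (hm : ∀ i, IsCommExpansion (σ (FreeGroup.of i) * (FreeGroup.of i)⁻¹) (m i))
    {i j l : Fin n} (hij : i ≠ j) (hil : i ≠ l) (hjl : j ≠ l) :
    m i l i - m i i l = m j l j - m j j l := by
  have hρ := matCoeff_zero_familyRep (Pi.single i 1 : Fin n → ℂ) (Pi.single j 1) (Pi.single l 1)
  have hc := matCoeff_conj hρ ((hm j).matCoeff_one _ hρ) (FreeGroup.of i)
  have hg := matCoeff_one_rep_mul hρ (σ (FreeGroup.of i) * (FreeGroup.of i)⁻¹)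
    (FreeGroup.of i * (σ (FreeGroup.of j) * (FreeGroup.of j)⁻¹) * (FreeGroup.of i)⁻¹)
  rw [hc.1, (hm i).matCoeff_one _ hρ, add_zero] at hg
  have h := trace_matCoeff_three_mul_left hρ hg (FreeGroup.of i * FreeGroup.of j)
  -- Writing `g_i = σ(x_i) x_i⁻¹`, one has `σ(x_i x_j) = g_i (x_i g_j x_i⁻¹) (x_i x_j)`, and the
  -- conjugation is invisible to second order.
  have e : σ (FreeGroup.of i) * (FreeGroup.of i)⁻¹ *
      (FreeGroup.of i * (σ (FreeGroup.of j) * (FreeGroup.of j)⁻¹) * (FreeGroup.of i)⁻¹) *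
      (FreeGroup.of i * FreeGroup.of j) = σ (FreeGroup.of i * FreeGroup.of j) := by
    rw [map_mul]; group
  rw [e, trace_matCoeff_eq hσ hρ _ (by norm_num), left_eq_add, matCoeff_two_rep_mul hρ, hc.1,
    hc.2, (hm i).matCoeff_two _ hρ, (hm j).matCoeff_two _ hρ,
    matCoeff_one_rep_mul hρ (FreeGroup.of i) (FreeGroup.of j)] at h
  simp only [matCoeff_one_familyRep_of, traceless_single, bracketSum_of_support,
    coeff_eq_of_distinct hσ hij hil (hm i), coeff_eq_of_distinct hσ hij.symm hjl (hm j)] at h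
  simp [hij, hil, hij.symm, hjl, traceless, Matrix.trace_fin_two] at h
  have h' : ((m i l i - m i i l : ℤ) : ℂ) = ((m j l j - m j j l : ℤ) : ℂ) := by
    push_cast
    linear_combination h / 2
  exact_mod_cast h'

/-- The terms at `(k, l)` and `(l, k)` cancel in the difference of the two sides. The diagonal needs
`hc0` separately, as `M` may have 2-torsion; this also leaves `μ i` free. -/
theorem sum_sum_smul_alternating {M : Type*} [AddCommGroup M] (c : Fin n → Fin n → M)
    (hc : ∀ k l, c k l = - c l k) (hc0 : ∀ k, c k k = 0) (m : Fin n → Fin n → ℤ) (μ : Fin n → ℤ)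
    (i : Fin n) (h1 : ∀ k l, i ≠ k → i ≠ l → m k l = m l k)
    (h2 : ∀ k, k ≠ i → m k i - m i k = μ k) :
    ∑ k, ∑ l, m k l • c k l = ∑ k, μ k • c k i := by
  have e : ∑ k, μ k • c k i = ∑ k, ∑ l, if l = i then μ k • c k l else 0 := by simp
  rw [e, ← sub_eq_zero, ← Finset.sum_sub_distrib]
  simp only [← Finset.sum_sub_distrib]
  rw [← Fintype.sum_prod_type'
    (f := fun k l => m k l • c k l - if l = i then μ k • c k l else 0)]
  refine Finset.sum_involution (fun p _ => p.swap) ?_ ?_ (fun _ _ => Finset.mem_univ _)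
    (fun p _ => p.swap_swap)
  · rintro ⟨k, l⟩ -
    change (m k l • c k l - if l = i then μ k • c k l else 0) +
      (m l k • c l k - if k = i then μ l • c l k else 0) = 0
    by_cases hk : k = i
    · by_cases hl : l = i
      · rw [hk, hl, hc0]; simp
      · rw [if_neg hl, if_pos hk, ← h2 l hl, hc k l, hk, sub_smul, smul_neg]
        abel
    · by_cases hl : l = i
      · rw [if_pos hl, if_neg hk, ← h2 k hk, hc l k, hl, sub_smul, smul_neg]
        abel
      · rw [if_neg hl, if_neg hk, h1 k l (Ne.symm hk) (Ne.symm hl), hc l k, smul_neg]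
        abel
  · rintro ⟨k, l⟩ - hne heq
    have hkl : l = k := congrArg Prod.fst heq
    subst hkl
    exact hne (by simp [hc0])

theorem exists_expSum_eq (μ : Fin n → ℤ) : ∃ h : FreeGroup (Fin n), ∀ k, expSum k h = μ k := by
  refine ⟨((List.finRange n).map fun l => FreeGroup.of l ^ μ l).prod, fun k => ?_⟩
  have h : expSum k ((List.finRange n).map fun l => FreeGroup.of l ^ μ l).prod =
      ((List.finRange n).map fun l => if l = k then μ l else 0).sum := by
    simp only [expSum, map_list_prod, toAdd_list_sum, List.map_map]
    congr 1
    refine List.map_congr_left fun l _ => ?_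
    simp
  rw [h, ← Fin.sum_univ_def]
  simp

/-- An automorphism acting trivially on `J / J²` is inner modulo `Γ(3)`. -/
theorem exists_mk_eq_mk_conj (hn : 3 ≤ n) {σ : MulAut (FreeGroup (Fin n))} (hσ : σ ∈ E n 1) :
    ∃ h : FreeGroup (Fin n), ∀ i, (QuotientGroup.mk (σ (FreeGroup.of i)) :
      _ ⧸ (⊤ : Subgroup (FreeGroup (Fin n))).lowerCentralSeries 2) =
        QuotientGroup.mk (h * FreeGroup.of i * h⁻¹) := by
  have hm : ∀ i, ∃ m, IsCommExpansion (σ (FreeGroup.of i) * (FreeGroup.of i)⁻¹) m := fun i =>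
    exists_isCommExpansion (mem_commutator_of_expSum_eq_zero fun k => by
      rw [expSum_mul, expSum_inv, expSum_eq hn hσ, add_neg_cancel])
  choose m hm using hm
  have : Nontrivial (Fin n) := Fin.nontrivial_iff_two_le.2 (by omega)
  -- The common value is read off at any one `j ≠ l`; it becomes the exponent sum of `x_l` in the
  -- conjugating element.
  have hμ : ∀ l, ∃ c : ℤ, ∀ i, l ≠ i → m i l i - m i i l = c := by
    intro l
    obtain ⟨j, hj⟩ := exists_ne l
    refine ⟨m j l j - m j j l, fun i hi => ?_⟩
    rcases eq_or_ne i j with rfl | hij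
    · rfl
    · exact coeff_sub_eq_coeff_sub hσ hm hij hi.symm hj
  choose μ hμ using hμ
  obtain ⟨h, hh⟩ := exists_expSum_eq μ
  refine ⟨h, fun i => ?_⟩
  have e1 : commMod h (FreeGroup.of i) = ∑ k, μ k • commMod (FreeGroup.of k) (FreeGroup.of i) := by
    rw [eq_sum_expSum_smul (fun x => commMod x (FreeGroup.of i))
      (fun x y => commMod_mul_left x y _)]
    simp only [hh]
  have e2 := (hm i).mk_eq
  rw [sum_sum_smul_alternating (fun k l => commMod (FreeGroup.of k) (FreeGroup.of l))
    (fun _ _ => commMod_swap _ _) (fun _ => commMod_self _) (m i) μ i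
    (fun k l hk hl => coeff_eq_of_distinct hσ hk hl (hm i)) (fun k hk => hμ k i hk), ← e1,
    coe_commMod] at e2
  have e3 := congrArg (· * (QuotientGroup.mk (FreeGroup.of i) :
    _ ⧸ (⊤ : Subgroup (FreeGroup (Fin n))).lowerCentralSeries 2)) e2
  simp only [← QuotientGroup.mk_mul, inv_mul_cancel_right] at e3
  rw [e3, commutatorElement_def, inv_mul_cancel_right]

end Johnson

end Fricke

end

open scoped Pointwise in
theorem mainTheorem2 (n : ℕ) (hn : 3 ≤ n) :
    (Fricke.E n 1 : Set (MulAut (FreeGroup (Fin n)))) =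
      ((MulAut.conj : FreeGroup (Fin n) →* MulAut (FreeGroup (Fin n))).range :
          Set (MulAut (FreeGroup (Fin n)))) *
        (Fricke.andreadakisJohnson (FreeGroup (Fin n)) 2 : Set (MulAut (FreeGroup (Fin n)))) := by
  apply Set.Subset.antisymm
  · intro σ hσ
    obtain ⟨h, hh⟩ := Fricke.exists_mk_eq_mk_conj hn hσ
    refine Set.mem_mul.2 ⟨MulAut.conj h, ⟨h, rfl⟩, (MulAut.conj h)⁻¹ * σ, ?_,
      mul_inv_cancel_left _ _⟩
    let π := QuotientGroup.mk' ((⊤ : Subgroup (FreeGroup (Fin n))).lowerCentralSeries 2)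
    -- Both sides are homomorphisms, so agreement on generators suffices.
    have key : π.comp ((MulAut.conj h)⁻¹ * σ).toMonoidHom = π := by
      refine FreeGroup.ext_hom _ _ fun i => ?_
      change π (h⁻¹ * σ (FreeGroup.of i) * h) = π (FreeGroup.of i)
      have hi : π (σ (FreeGroup.of i)) = π (h * FreeGroup.of i * h⁻¹) := hh i
      rw [map_mul, map_mul, hi, ← map_mul, ← map_mul]
      congr 1
      group
    refine MonoidHom.mem_ker.2 (MulEquiv.ext fun x => ?_)
    induction x using QuotientGroup.induction_on with
    | _ x => exact DFunLike.congr_fun key x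
  · rintro _ ⟨σ, hσ, τ, hτ, rfl⟩
    exact mul_mem (Fricke.conj_range_le hσ) (Fricke.andreadakisJohnson_two_le hτ)
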